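/- Let $g \ge 6$ be an integer. Let $J = \begin{pmatrix} 0 & -I_g \\ I_g & 0 \end{pmatrix}$ and let $\mathrm{Sp}(2g,\mathbb{Z}) = \{A \in M_{2g}(\mathbb{Z}) : A J A^{T} = J\}$ be the integral symplectic group. Then $\mathrm{Sp}(2g,\mathbb{Z})$ is generated by three involutions: there are three pairwise distinct elements $x, y, z \in \mathrm{Sp}(2g,\mathbb{Z})$, each of order exactly two, such that the subgroup generated by $\{x, y, z\}$ is all of $\mathrm{Sp}(2g,\mathbb{Z})$. -/

import Mathlib

/-! Call each pair of dual basis vectors (e_i, f_i) a handle. Permutations of the g handles are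
symplectic, and the reflections i ↦ 1 - i and i ↦ -i of ℤ/g compose to the g-cycle. These give x and
y. The third involution is z = xh with h = psr, where p, s, r have disjoint supports: p transposes
two handles, while s and r are elements of order three on two handles each. Since x exchanges the
two handles of each pair, it inverts p, s and r, so z² = 1.

As p has order two, h³ = p; with the cycle xy this yields all permutations of the handles. A
transposition that inverts r and fixes s then separates s from r (`exists_three_involutions`).

From s, r and the permutations come short root elements, and three of them multiply to the inverse
of a transvection (`IsShortRoot.mul_mul_eq_T_inv`). Conjugation produces the family in
`HasTransvections`, and the Euclidean algorithm shows that this family generates the whole group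
(`HasTransvections.eq_top`). -/

open Matrix

namespace SymplecticInvolutions

/-! ### The symplectic form, summed over handles. -/

section Form

variable {l : Type*} [Fintype l]

/-- The standard symplectic form on `l → ℤ × ℤ`. -/
def om (x y : l → ℤ × ℤ) : ℤ := ∑ i, ((x i).1 * (y i).2 - (x i).2 * (y i).1)

theorem om_add_left (x y z : l → ℤ × ℤ) : om (x + y) z = om x z + om y z := by
  simp only [om, ← Finset.sum_add_distrib]
  exact Finset.sum_congr rfl fun i _ => by simp; ring

theorem om_smul_left (c : ℤ) (x y : l → ℤ × ℤ) : om (c • x) y = c * om x y := by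
  simp only [om, Finset.mul_sum]
  exact Finset.sum_congr rfl fun i _ => by simp; ring

theorem om_swap (x y : l → ℤ × ℤ) : om x y = -om y x := by
  simp only [om, ← Finset.sum_neg_distrib]
  exact Finset.sum_congr rfl fun i _ => by ring

theorem om_add_right (x y z : l → ℤ × ℤ) : om x (y + z) = om x y + om x z := by
  rw [om_swap, om_add_left, om_swap y, om_swap z]; ring

theorem om_smul_right (c : ℤ) (x y : l → ℤ × ℤ) : om x (c • y) = c * om x y := by
  rw [om_swap, om_smul_left, om_swap y]; ring

theorem om_neg_left (x y : l → ℤ × ℤ) : om (-x) y = -om x y := by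
  simpa using om_smul_left (-1) x y

theorem om_neg_right (x y : l → ℤ × ℤ) : om x (-y) = -om x y := by
  simpa using om_smul_right (-1) x y

theorem om_sub_left (x y z : l → ℤ × ℤ) : om (x - y) z = om x z - om y z := by
  rw [sub_eq_add_neg, om_add_left, om_neg_left, sub_eq_add_neg]

theorem om_sub_right (x y z : l → ℤ × ℤ) : om x (y - z) = om x y - om x z := by
  rw [sub_eq_add_neg, om_add_right, om_neg_right, sub_eq_add_neg]

theorem om_self (x : l → ℤ × ℤ) : om x x = 0 := by
  have := om_swap x x
  omega

theorem om_single_right [DecidableEq l] (x : l → ℤ × ℤ) (a : l) (u : ℤ × ℤ) :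
    om x (Pi.single a u) = (x a).1 * u.2 - (x a).2 * u.1 := by
  rw [om, Finset.sum_eq_single a]
  · simp
  · intro b _ hb
    simp [hb]
  · simp

theorem om_single_left [DecidableEq l] (x : l → ℤ × ℤ) (a : l) (u : ℤ × ℤ) :
    om (Pi.single a u) x = u.1 * (x a).2 - u.2 * (x a).1 := by
  rw [om_swap, om_single_right]; ring

end Form

/-! ### Symplectic matrices as isometries; transvections. -/

variable {l : Type*} [Fintype l] [DecidableEq l]

/-- Grouping the coordinates of a vector by handles. -/
def coords (l : Type*) : (l ⊕ l → ℤ) ≃ₗ[ℤ] (l → ℤ × ℤ) where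
  toFun x i := (x (Sum.inl i), x (Sum.inr i))
  invFun y := Sum.elim (fun i => (y i).1) (fun i => (y i).2)
  map_add' _ _ := rfl
  map_smul' _ _ := rfl
  left_inv x := by ext (i | i) <;> rfl
  right_inv _ := rfl

theorem om_coords (x y : l ⊕ l → ℤ) : om (coords l x) (coords l y) = -(x ⬝ᵥ J l ℤ *ᵥ y) := by
  obtain ⟨x, rfl⟩ := (coords l).symm.surjective x
  obtain ⟨y, rfl⟩ := (coords l).symm.surjective y
  simp only [LinearEquiv.apply_symm_apply]
  have hx : ∀ y : l → ℤ × ℤ, (coords l).symm y = Sum.elim (fun i => (y i).1) (fun i => (y i).2) :=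
    fun _ => rfl
  simp only [hx, J, om, Matrix.fromBlocks_mulVec, dotProduct,
    Fintype.sum_sum_type, Sum.elim_inl, Sum.elim_inr]
  simp [Finset.sum_sub_distrib, Matrix.neg_mulVec, Function.comp_def]
  ring

/-- The action of a symplectic matrix on `l → ℤ × ℤ`. -/
def act (M : symplecticGroup l ℤ) : (l → ℤ × ℤ) →ₗ[ℤ] (l → ℤ × ℤ) :=
  (coords l).toLinearMap ∘ₗ Matrix.toLin' (M : Matrix (l ⊕ l) (l ⊕ l) ℤ) ∘ₗ
    (coords l).symm.toLinearMap

theorem act_apply (M : symplecticGroup l ℤ) (x : l → ℤ × ℤ) :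
    act M x = coords l ((M : Matrix (l ⊕ l) (l ⊕ l) ℤ) *ᵥ (coords l).symm x) := rfl

@[simp]
theorem act_one (x : l → ℤ × ℤ) : act (1 : symplecticGroup l ℤ) x = x := by
  simp [act_apply]

@[simp]
theorem act_mul (M N : symplecticGroup l ℤ) (x : l → ℤ × ℤ) :
    act (M * N) x = act M (act N x) := by
  simp [act_apply, Matrix.mulVec_mulVec]

@[simp]
theorem act_inv_act (M : symplecticGroup l ℤ) (x : l → ℤ × ℤ) : act M⁻¹ (act M x) = x := by
  rw [← act_mul, inv_mul_cancel, act_one]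

@[simp]
theorem act_act_inv (M : symplecticGroup l ℤ) (x : l → ℤ × ℤ) : act M (act M⁻¹ x) = x := by
  rw [← act_mul, mul_inv_cancel, act_one]

theorem act_inv_of_act {M : symplecticGroup l ℤ} {x y : l → ℤ × ℤ} (h : act M x = y) :
    act M⁻¹ y = x := by
  rw [← h, act_inv_act]

theorem act_ext {M N : symplecticGroup l ℤ} (h : ∀ x, act M x = act N x) : M = N := by
  apply Subtype.ext
  apply Matrix.toLin'.injective
  ext1 i
  have := h (coords l (Pi.single i 1))
  simp only [act_apply, LinearEquiv.symm_apply_apply, EmbeddingLike.apply_eq_iff_eq] at this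
  ext j
  simpa using congrFun this j

theorem om_act (M : symplecticGroup l ℤ) (x y : l → ℤ × ℤ) : om (act M x) (act M y) = om x y := by
  obtain ⟨x, rfl⟩ := (coords l).surjective x
  obtain ⟨y, rfl⟩ := (coords l).surjective y
  simp only [act_apply, LinearEquiv.symm_apply_apply, om_coords]
  have h := SymplecticGroup.mem_iff'.1 M.2
  rw [Matrix.mulVec_mulVec, ← Matrix.vecMul_transpose, ← Matrix.dotProduct_mulVec,
    Matrix.mulVec_mulVec, ← Matrix.mul_assoc, h]

/-- A form-preserving linear map as a symplectic matrix. -/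
def mk (f : (l → ℤ × ℤ) →ₗ[ℤ] (l → ℤ × ℤ)) (hf : ∀ x y, om (f x) (f y) = om x y) :
    symplecticGroup l ℤ :=
  ⟨LinearMap.toMatrix' ((coords l).symm.toLinearMap ∘ₗ f ∘ₗ (coords l).toLinearMap), by
    rw [SymplecticGroup.mem_iff']
    have key : ∀ x y : l ⊕ l → ℤ, x ⬝ᵥ ((LinearMap.toMatrix' ((coords l).symm.toLinearMap ∘ₗ f ∘ₗ
        (coords l).toLinearMap))ᵀ * J l ℤ * (LinearMap.toMatrix' ((coords l).symm.toLinearMap ∘ₗ f ∘ₗ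
        (coords l).toLinearMap))) *ᵥ y = x ⬝ᵥ J l ℤ *ᵥ y := by
      intro x y
      rw [Matrix.mul_assoc, ← Matrix.mulVec_mulVec, Matrix.dotProduct_mulVec,
        Matrix.vecMul_transpose, ← Matrix.mulVec_mulVec]
      have h1 := hf (coords l x) (coords l y)
      rw [om_coords] at h1
      rw [LinearMap.toMatrix'_mulVec, LinearMap.toMatrix'_mulVec]
      have h2 := om_coords ((coords l).symm (f (coords l x))) ((coords l).symm (f (coords l y)))
      simp only [LinearEquiv.apply_symm_apply] at h2
      simp only [LinearMap.coe_comp, LinearEquiv.coe_coe, Function.comp_apply]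
      linarith
    ext i j
    have := key (Pi.single i 1) (Pi.single j 1)
    simpa using this⟩

@[simp]
theorem act_mk (f : (l → ℤ × ℤ) →ₗ[ℤ] (l → ℤ × ℤ)) (hf : ∀ x y, om (f x) (f y) = om x y)
    (x : l → ℤ × ℤ) : act (mk f hf) x = f x := by
  rw [act_apply, mk, LinearMap.toMatrix'_mulVec]
  simp

/-- The transvection `x ↦ x + ω(x, v) v`. -/
def T (v : l → ℤ × ℤ) : symplecticGroup l ℤ :=
  mk { toFun := fun x => x + om x v • v
       map_add' := fun x y => by rw [om_add_left, add_smul]; abel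
       map_smul' := fun c x => by simp [om_smul_left, smul_add, mul_smul, -zsmul_eq_mul] } fun x y => by
    simp only [LinearMap.coe_mk, AddHom.coe_mk, om_add_left, om_add_right, om_smul_left,
      om_smul_right, om_self]
    rw [om_swap v y]; ring

theorem act_T (v x : l → ℤ × ℤ) : act (T v) x = x + om x v • v := by
  simp [T]

theorem T_conj (M : symplecticGroup l ℤ) (v : l → ℤ × ℤ) : M * T v * M⁻¹ = T (act M v) := by
  refine act_ext fun x => ?_
  obtain ⟨x, rfl⟩ : ∃ y, x = act M y := ⟨act M⁻¹ x, by simp⟩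
  simp [act_T, om_act, -zsmul_eq_mul]

theorem T_neg (v : l → ℤ × ℤ) : T (-v) = T v := by
  refine act_ext fun x => ?_
  simp [act_T, om_neg_right]

theorem act_T_inv (v x : l → ℤ × ℤ) : act (T v)⁻¹ x = x - om x v • v := by
  have h : act (T v) (x - om x v • v) = x := by
    rw [act_T, om_sub_left, om_smul_left, om_self]
    module
  rw [← h, act_inv_act, h]

theorem act_T_zpow (v x : l → ℤ × ℤ) (k : ℤ) : act (T v ^ k) x = x + (k * om x v) • v := by
  induction k generalizing x with
  | zero => simp
  | succ n ih =>
    rw [_root_.zpow_add_one, act_mul, act_T, ih, om_add_left, om_smul_left, om_self]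
    module
  | pred n ih =>
    rw [_root_.zpow_sub_one, act_mul, act_T_inv, ih, om_sub_left, om_smul_left, om_self]
    module

/-- The elements of `H` acting trivially on the handles in `s`. -/
def fixer (H : Subgroup (symplecticGroup l ℤ)) (s : Finset l) :
    Subgroup (symplecticGroup l ℤ) where
  carrier := {h | h ∈ H ∧ ∀ i ∈ s, ∀ u, act h (Pi.single i u) = Pi.single i u}
  mul_mem' ha hb := ⟨H.mul_mem ha.1 hb.1, fun i hi u => by
    rw [act_mul, hb.2 i hi, ha.2 i hi]⟩
  one_mem' := ⟨H.one_mem, fun i _ u => act_one _⟩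
  inv_mem' ha := ⟨H.inv_mem ha.1, fun i hi u => by
    conv_lhs => rw [← ha.2 i hi u]
    simp⟩

theorem T_mem_fixer {H : Subgroup (symplecticGroup l ℤ)} {s : Finset l} {v : l → ℤ × ℤ}
    (hv : T v ∈ H) (hs : ∀ i ∈ s, v i = 0) : T v ∈ fixer H s :=
  ⟨hv, fun i hi u => by simp [act_T, om_single_left, hs i hi]⟩

theorem act_eq_zero_of_mem_fixer {H : Subgroup (symplecticGroup l ℤ)} {s : Finset l}
    {h : symplecticGroup l ℤ} (hh : h ∈ fixer H s) {x : l → ℤ × ℤ} (hx : ∀ i ∈ s, x i = 0) :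
    ∀ i ∈ s, act h x i = 0 := by
  intro i hi
  have h1 : ∀ u, om (act h x) (Pi.single i u) = 0 := fun u => by
    rw [← hh.2 i hi u, om_act, om_single_right, hx i hi]; simp
  have h2 := h1 (0, 1)
  have h3 := h1 (1, 0)
  simp only [om_single_right] at h2 h3
  ext <;> simp <;> linarith

/-- The first basis vector of handle `i`. -/
abbrev eb (i : l) : l → ℤ × ℤ := Pi.single i (1, 0)

/-- The second basis vector of handle `i`. -/
abbrev fb (i : l) : l → ℤ × ℤ := Pi.single i (0, 1)

/-- The subgroup contains a family of transvections generating the integral symplectic group. -/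
structure HasTransvections (H : Subgroup (symplecticGroup l ℤ)) : Prop where
  e_mem : ∀ i, T (eb i) ∈ H
  f_mem : ∀ i, T (fb i) ∈ H
  ef_mem : ∀ i j, i ≠ j → T (fb i + eb j) ∈ H

theorem natAbs_emod_lt (a : ℤ) {b : ℤ} (hb : b ≠ 0) : (a % b).natAbs < b.natAbs := by
  zify
  rw [abs_of_nonneg (Int.emod_nonneg a hb)]
  exact Int.emod_lt_abs a hb

/-! ### Generation by transvections: Euclidean reduction. -/

namespace HasTransvections

variable {H : Subgroup (symplecticGroup l ℤ)} {s : Finset l}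

theorem e_mem_fixer (hH : HasTransvections H) {i : l} (hi : i ∉ s) : T (eb i) ∈ fixer H s :=
  T_mem_fixer (hH.e_mem i) fun j hj => by
    have hji : j ≠ i := by rintro rfl; exact hi hj
    simp [hji]

theorem f_mem_fixer (hH : HasTransvections H) {i : l} (hi : i ∉ s) : T (fb i) ∈ fixer H s :=
  T_mem_fixer (hH.f_mem i) fun j hj => by
    have hji : j ≠ i := by rintro rfl; exact hi hj
    simp [hji]

/-- The product T(e)T(f)T(e) is the quarter turn of SL₂(ℤ); its square is -1 on the handle. -/
theorem exists_rotate (hH : HasTransvections H) {i : l} (hi : i ∉ s) :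
    ∃ h ∈ fixer H s, ∀ x, act h x = Function.update x i (-(x i).2, (x i).1) := by
  refine ⟨T (eb i) * T (fb i) * T (eb i), mul_mem (mul_mem (hH.e_mem_fixer hi)
    (hH.f_mem_fixer hi)) (hH.e_mem_fixer hi), fun x => ?_⟩
  funext j
  rcases eq_or_ne j i with rfl | hj
  · simp only [act_mul, act_T, om_single_right, Function.update_self, Pi.add_apply, Pi.smul_apply,
      Pi.single_eq_same]
    ext <;> simp
  · simp [act_T, hj]

/-- One division step inside a handle: a power of T(e) reduces the first coordinate, and the quarter
turn moves the remainder to the second. -/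
theorem exists_snd_emod (hH : HasTransvections H) {i : l} (hi : i ∉ s) (x : l → ℤ × ℤ) :
    ∃ h ∈ fixer H s, act h x = Function.update x i (-(x i).2, (x i).1 % (x i).2) := by
  obtain ⟨h, hh, hx⟩ := hH.exists_rotate hi
  refine ⟨h * T (eb i) ^ ((x i).1 / (x i).2),
    mul_mem hh (zpow_mem (hH.e_mem_fixer hi) _), ?_⟩
  rw [act_mul, hx, act_T_zpow]
  funext j
  rcases eq_or_ne j i with rfl | hj
  · have := Int.emod_def (x j).1 (x j).2
    simp [om_single_right]
    rw [this]; ring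
  · simp [hj]

theorem exists_snd_eq_zero (hH : HasTransvections H) (x : l → ℤ × ℤ) (hx : ∀ i ∈ s, x i = 0) :
    ∃ h ∈ fixer H s, ∀ i, (act h x i).2 = 0 := by
  induction hn : ∑ i, (x i).2.natAbs using Nat.strong_induction_on generalizing x with
  | _ n ih =>
    by_cases h0 : ∀ i, (x i).2 = 0
    · exact ⟨1, one_mem _, by simpa using h0⟩
    push Not at h0
    obtain ⟨i, hi0⟩ := h0
    have hi : i ∉ s := fun hi => hi0 (by rw [hx i hi]; rfl)
    obtain ⟨h, hh, hhx⟩ := hH.exists_snd_emod hi x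
    obtain ⟨k, hk, hk0⟩ := ih (∑ i, (act h x i).2.natAbs) (by
      rw [← hn]
      refine Finset.sum_lt_sum (fun j _ => ?_) ⟨i, Finset.mem_univ i, ?_⟩
      · rcases eq_or_ne j i with rfl | hj
        · simp only [hhx, Function.update_self]
          exact (natAbs_emod_lt _ hi0).le
        · simp [hhx, hj]
      · simp only [hhx, Function.update_self]
        exact natAbs_emod_lt _ hi0) (act h x) (act_eq_zero_of_mem_fixer hh hx) rfl
    exact ⟨k * h, mul_mem hk hh, by simpa using hk0⟩

/-- On the Lagrangian spanned by the e's, T(f_i + e_j)T(f_i)⁻¹ is an elementary operation, so its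
powers allow division between handles. -/
theorem exists_add_smul (hH : HasTransvections H) {i j : l} (hi : i ∉ s) (hj : j ∉ s) (hij : i ≠ j)
    (k : ℤ) : ∃ h ∈ fixer H s, ∀ x, (∀ i, (x i).2 = 0) →
      act h x = x + (k * (x i).1) • eb j := by
  set E := T (fb i + eb j) * (T (fb i))⁻¹ with hE
  have hEm : E ∈ fixer H s := by
    refine mul_mem (T_mem_fixer (hH.ef_mem i j hij) fun m hm => ?_) (inv_mem (hH.f_mem_fixer hi))
    have h1 : m ≠ i := by rintro rfl; exact hi hm
    have h2 : m ≠ j := by rintro rfl; exact hj hm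
    simp [h1, h2]
  have h1 : ∀ x, (∀ i, (x i).2 = 0) → act E x = x + (x i).1 • eb j := fun x hx => by
    rw [hE, act_mul, act_T_inv, act_T]
    simp [om_add_right, om_single_right, hx, hij.symm, -zsmul_eq_mul]
    abel
  have h2 : ∀ x, (∀ i, (x i).2 = 0) → act E⁻¹ x = x - (x i).1 • eb j := fun x hx => by
    have h3 := h1 (x - (x i).1 • eb j) fun m => by
      rcases eq_or_ne m j with rfl | hm <;> simp [*]
    have h4 : act E (x - (x i).1 • eb j) = x := by
      rw [h3]
      simp [Pi.single_eq_of_ne hij]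
    conv_lhs => rw [← h4, act_inv_act]
  refine ⟨E ^ k, zpow_mem hEm k, ?_⟩
  induction k with
  | zero => intro x _; simp
  | succ n ih =>
    intro x hx
    rw [_root_.zpow_add_one, act_mul, h1 x hx, ih]
    · simp [Pi.single_eq_of_ne hij, -zsmul_eq_mul]
      module
    · intro m
      rcases eq_or_ne m j with rfl | hm <;> simp [*]
  | pred n ih =>
    intro x hx
    rw [_root_.zpow_sub_one, act_mul, h2 x hx, ih]
    · simp [Pi.single_eq_of_ne hij, -zsmul_eq_mul]
      module
    · intro m
      rcases eq_or_ne m j with rfl | hm <;> simp [*]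

theorem exists_fst_emod (hH : HasTransvections H) {i j : l} (hi : i ∉ s) (hj : j ∉ s) (hij : i ≠ j)
    (x : l → ℤ × ℤ) (hx : ∀ i, (x i).2 = 0) : ∃ h ∈ fixer H s,
      act h x = Function.update (Function.update x j ((x i).1, 0)) i (-((x j).1 % (x i).1), 0) := by
  -- With remainder r, the coordinates (x_i, x_j) become (x_i, r + x_i), then (-r, r + x_i), then
  -- (-r, x_i).
  obtain ⟨g₁, hm₁, h₁⟩ := hH.exists_add_smul hi hj hij (1 - (x j).1 / (x i).1)
  obtain ⟨g₂, hm₂, h₂⟩ := hH.exists_add_smul hj hi hij.symm (-1)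
  obtain ⟨g₃, hm₃, h₃⟩ := hH.exists_add_smul hi hj hij 1
  refine ⟨g₃ * g₂ * g₁, mul_mem (mul_mem hm₃ hm₂) hm₁, ?_⟩
  have hq := Int.emod_def (x j).1 (x i).1
  rw [act_mul, act_mul, h₁ x hx, h₂, h₃]
  · funext m
    rcases eq_or_ne m i with rfl | hmi
    · ext <;> simp [hij, hx, hq]
      ring
    rcases eq_or_ne m j with rfl | hmj
    · ext <;> simp [hij, hij.symm, hx, hq]
      ring
    · simp [hmi, hmj]
  all_goals
    intro m
    rcases eq_or_ne m i with rfl | hmi <;> rcases eq_or_ne m j with rfl | hmj <;> simp [*]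

theorem exists_eq_single (hH : HasTransvections H) {a : l} (ha : a ∉ s) (x : l → ℤ × ℤ)
    (hx : ∀ i ∈ s, x i = 0) (hx2 : ∀ i, (x i).2 = 0) :
    ∃ h ∈ fixer H s, ∃ c, act h x = Pi.single a (c, 0) := by
  induction hn : ∑ i ∈ Finset.univ.erase a, (x i).1.natAbs using Nat.strong_induction_on
    generalizing x with
  | _ n ih =>
    by_cases h0 : ∀ i, i ≠ a → (x i).1 = 0
    · refine ⟨1, one_mem _, (x a).1, ?_⟩
      funext i
      rcases eq_or_ne i a with rfl | hi
      · ext <;> simp [hx2]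
      · ext <;> simp [hi, hx2, h0 i hi]
    push Not at h0
    obtain ⟨i, hia, hi0⟩ := h0
    have hi : i ∉ s := fun hi => hi0 (by rw [hx i hi]; rfl)
    obtain ⟨h, hh, hhx⟩ := hH.exists_fst_emod hi ha hia x hx2
    have hlt : (act h x i).1.natAbs < (x i).1.natAbs := by
      simp only [hhx, Function.update_self, Int.natAbs_neg]
      exact natAbs_emod_lt _ hi0
    obtain ⟨k, hk, c, hkc⟩ := ih (∑ i ∈ Finset.univ.erase a, (act h x i).1.natAbs) (by
      rw [← hn]
      refine Finset.sum_lt_sum (fun j hj => ?_) ⟨i, by simpa using hia, hlt⟩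
      rcases eq_or_ne j i with rfl | hji
      · exact hlt.le
      · simp [hhx, hji, Finset.ne_of_mem_erase hj]) (act h x) (act_eq_zero_of_mem_fixer hh hx)
        (fun j => by
          rw [hhx]
          rcases eq_or_ne j i with rfl | hji
          · simp
          rcases eq_or_ne j a with rfl | hja
          · simp [hji]
          · simp [hji, hja, hx2]) rfl
    exact ⟨k * h, mul_mem hk hh, c, by simpa using hkc⟩

theorem exists_eq_e (hH : HasTransvections H) {a : l} (ha : a ∉ s) (x y : l → ℤ × ℤ)
    (hx : ∀ i ∈ s, x i = 0) (hxy : om x y = 1) : ∃ h ∈ fixer H s, act h x = eb a := by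
  obtain ⟨g₁, hm₁, h₁⟩ := hH.exists_snd_eq_zero x hx
  obtain ⟨g₂, hm₂, c, h₂⟩ :=
    hH.exists_eq_single ha (act g₁ x) (act_eq_zero_of_mem_fixer hm₁ hx) h₁
  -- A vector pairing to 1 with another is primitive, so the gcd left by the reduction is ±1.
  have hc : IsUnit c := by
    rw [← om_act (g₂ * g₁), act_mul, h₂, om_single_left] at hxy
    exact IsUnit.of_mul_eq_one (M := ℤ) _ (by simpa using hxy)
  rcases Int.isUnit_iff.1 hc with rfl | rfl
  · exact ⟨g₂ * g₁, mul_mem hm₂ hm₁, by simpa using h₂⟩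
  · obtain ⟨g₃, hm₃, h₃⟩ := hH.exists_rotate ha
    refine ⟨g₃ * g₃ * (g₂ * g₁), mul_mem (mul_mem hm₃ hm₃) (mul_mem hm₂ hm₁), ?_⟩
    simp only [act_mul, h₂, h₃]
    funext j
    rcases eq_or_ne j a with rfl | hj <;> simp [*]

/-- Once x is e_a, a power of T(e_a) turns y into y' with ω(f_a, y') = 1. Then T(y' - f_a) fixes e_a
and sends f_a to y'; it is available because y' - f_a is primitive, so this transvection is
conjugate to T(e_a). -/
theorem exists_eq_e_eq_f (hH : HasTransvections H) {a : l} (ha : a ∉ s) (x y : l → ℤ × ℤ)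
    (hx : ∀ i ∈ s, x i = 0) (hy : ∀ i ∈ s, y i = 0) (hxy : om x y = 1) :
    ∃ h ∈ fixer H s, act h x = eb a ∧ act h y = fb a := by
  obtain ⟨g₁, hm₁, h₁⟩ := hH.exists_eq_e ha x y hx hxy
  -- This k makes the e_a-coordinate of y' equal to -1.
  obtain ⟨k, hk⟩ : ∃ k : ℤ, k = -(act g₁ y a).1 - 1 := ⟨_, rfl⟩
  obtain ⟨y', hy'⟩ : ∃ y', y' = act (T (eb a) ^ (-k)) (act g₁ y) := ⟨_, rfl⟩
  have hyE : om (act g₁ y) (eb a) = -1 := by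
    rw [← h₁, om_act, om_swap, hxy]
  have hEy : om (eb a) y' = 1 := by
    rw [hy', act_T_zpow, om_add_right, om_smul_right, om_self, om_swap, hyE]; simp
  have hFy : om (fb a) y' = 1 := by
    rw [hy', act_T_zpow, hyE, om_add_right, om_smul_right, om_single_left, om_single_left, hk]
    simp
  have hs' : ∀ i ∈ s, (y' - fb a) i = 0 := fun i hi => by
    have hia : i ≠ a := by rintro rfl; exact ha hi
    simp only [Pi.sub_apply, Pi.single_eq_of_ne hia, sub_zero]
    rw [hy']
    exact act_eq_zero_of_mem_fixer (zpow_mem (hH.e_mem_fixer ha) _)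
      (act_eq_zero_of_mem_fixer hm₁ hy) i hi
  obtain ⟨g₂, hm₂, h₂⟩ := hH.exists_eq_e ha (y' - fb a) (-fb a) hs' (by
    rw [om_neg_right, om_sub_left, om_self, om_swap, hFy]; simp)
  have hTm : T (y' - fb a) ∈ fixer H s := by
    have : y' - fb a = act g₂⁻¹ (eb a) := (act_inv_of_act h₂).symm
    rw [this, ← T_conj]
    exact mul_mem (mul_mem (inv_mem hm₂) (hH.e_mem_fixer ha)) (inv_mem (inv_mem hm₂))
  have hT1 : act (T (y' - fb a)) (eb a) = eb a := by
    rw [act_T, om_sub_right, hEy, om_single_left]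
    simp
  have hT2 : act (T (y' - fb a)) (fb a) = y' := by
    rw [act_T, om_sub_right, hFy, om_self]
    simp
  refine ⟨(T (y' - fb a))⁻¹ * (T (eb a) ^ (-k) * g₁),
    mul_mem (inv_mem hTm) (mul_mem (zpow_mem (hH.e_mem_fixer ha) _) hm₁), ?_, ?_⟩
  · rw [act_mul, act_mul, h₁, act_T_zpow, om_self]
    simpa using act_inv_of_act hT1
  · rw [act_mul, act_mul, ← hy']
    exact act_inv_of_act hT2

theorem exists_fix (hH : HasTransvections H) (s : Finset l) (M : symplecticGroup l ℤ) :
    ∃ h ∈ H, ∀ i ∈ s, act (h * M) (eb i) = eb i ∧ act (h * M) (fb i) = fb i := by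
  induction s using Finset.induction_on with
  | empty => exact ⟨1, one_mem _, by simp⟩
  | insert a s ha ih =>
    obtain ⟨h, hh, hM⟩ := ih
    -- An isometry fixing the handles in s preserves their orthogonal complement, so the next handle
    -- can be treated there.
    have key : ∀ x, (∀ i ∈ s, x i = 0) → ∀ i ∈ s, act (h * M) x i = 0 := fun x hx i hi => by
      have h1 : om (act (h * M) x) (eb i) = 0 := by
        rw [← (hM i hi).1, om_act, om_single_right, hx i hi]; simp
      have h2 : om (act (h * M) x) (fb i) = 0 := by
        rw [← (hM i hi).2, om_act, om_single_right, hx i hi]; simp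
      simp only [om_single_right] at h1 h2
      ext
      · simpa using h2
      · simpa using h1
    have hsingle : ∀ u : ℤ × ℤ, ∀ i ∈ s, (Pi.single a u : l → ℤ × ℤ) i = 0 := fun u i hi => by
      have hia : i ≠ a := by rintro rfl; exact ha hi
      simp [hia]
    obtain ⟨k, hk, hke, hkf⟩ := hH.exists_eq_e_eq_f ha (act (h * M) (eb a)) (act (h * M) (fb a))
      (key _ (hsingle _)) (key _ (hsingle _)) (by rw [om_act, om_single_left]; simp)
    refine ⟨k * h, mul_mem hk.1 hh, fun i hi => ?_⟩
    rw [mul_assoc, act_mul k, act_mul k]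
    rcases Finset.mem_insert.1 hi with rfl | hi
    · exact ⟨hke, hkf⟩
    · rw [(hM i hi).1, (hM i hi).2]
      exact ⟨hk.2 i hi _, hk.2 i hi _⟩

theorem eq_one_of_fix {M : symplecticGroup l ℤ}
    (hM : ∀ i, act M (eb i) = eb i ∧ act M (fb i) = fb i) : M = 1 := by
  refine act_ext fun x => ?_
  have hx : x = ∑ i, ((x i).1 • eb i + (x i).2 • fb i) := by
    funext j
    rw [Finset.sum_apply, Finset.sum_eq_single j]
    · ext <;> simp
    · intro b _ hb
      simp [hb.symm]
    · simp
  rw [hx, map_sum, map_sum]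
  refine Finset.sum_congr rfl fun i _ => ?_
  rw [map_add, map_smul, map_smul, (hM i).1, (hM i).2, act_one]

theorem eq_top (hH : HasTransvections H) : H = ⊤ := by
  refine eq_top_iff.2 fun M _ => ?_
  obtain ⟨h, hh, hM⟩ := hH.exists_fix Finset.univ M
  have h1 := eq_one_of_fix fun i => hM i (Finset.mem_univ i)
  rw [eq_inv_of_mul_eq_one_right h1]
  exact inv_mem hh

end HasTransvections
-- Permutations of handles and elements supported on two handles.
/-- Permutations of the handles as symplectic matrices. -/
def P : Equiv.Perm l →* symplecticGroup l ℤ where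
  toFun π := mk (LinearMap.funLeft ℤ (ℤ × ℤ) π.symm) fun x y => by
    simp only [om, LinearMap.funLeft_apply]
    exact Equiv.sum_comp π.symm fun i => (x i).1 * (y i).2 - (x i).2 * (y i).1
  map_one' := act_ext fun x => by funext i; simp [LinearMap.funLeft_apply]; rfl
  map_mul' π ρ := act_ext fun x => by
    funext i; simp [LinearMap.funLeft_apply, Equiv.Perm.mul_def]

@[simp]
theorem act_P (π : Equiv.Perm l) (x : l → ℤ × ℤ) (i : l) : act (P π) x i = x (π.symm i) := by
  simp [P, LinearMap.funLeft_apply]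

@[simp]
theorem act_P_inv (π : Equiv.Perm l) (x : l → ℤ × ℤ) (i : l) : act (P π)⁻¹ x i = x (π i) := by
  rw [← map_inv, act_P]
  rfl

/-- A linear map preserves the symplectic form on a pair of handles. -/
def PairIsometry (F : (ℤ × ℤ) × (ℤ × ℤ) →ₗ[ℤ] (ℤ × ℤ) × (ℤ × ℤ)) : Prop :=
  ∀ p q, ((F p).1.1 * (F q).1.2 - (F p).1.2 * (F q).1.1) +
    ((F p).2.1 * (F q).2.2 - (F p).2.2 * (F q).2.1) =
    (p.1.1 * q.1.2 - p.1.2 * q.1.1) + (p.2.1 * q.2.2 - p.2.2 * q.2.1)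

section Loc

variable {F F' : (ℤ × ℤ) × (ℤ × ℤ) →ₗ[ℤ] (ℤ × ℤ) × (ℤ × ℤ)} {a b c d : l}

/-- The map acting by `F` on the pair of handles `(a, b)`. -/
def locFun (F : (ℤ × ℤ) × (ℤ × ℤ) →ₗ[ℤ] (ℤ × ℤ) × (ℤ × ℤ)) (a b : l) :
    (l → ℤ × ℤ) →ₗ[ℤ] (l → ℤ × ℤ) where
  toFun x i := if i = a then (F (x a, x b)).1 else if i = b then (F (x a, x b)).2 else x i
  map_add' x y := by
    funext i
    have : F ((x + y) a, (x + y) b) = F (x a, x b) + F (y a, y b) := by rw [← map_add]; rfl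
    simp only [Pi.add_apply] at this ⊢
    rw [this]
    split_ifs <;> rfl
  map_smul' k x := by
    funext i
    have : F ((k • x) a, (k • x) b) = k • F (x a, x b) := by rw [← map_smul]; rfl
    simp only [Pi.smul_apply, RingHom.id_apply] at this ⊢
    rw [this]
    split_ifs <;> rfl

/-- The symplectic matrix acting by `F` on the pair of handles `(a, b)`. -/
def loc (F : (ℤ × ℤ) × (ℤ × ℤ) →ₗ[ℤ] (ℤ × ℤ) × (ℤ × ℤ)) (hF : PairIsometry F) (a b : l)
    (hab : a ≠ b) : symplecticGroup l ℤ :=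
  mk (locFun F a b) fun x y => by
    have hsplit : ∀ z w : l → ℤ × ℤ, om z w = ((z a).1 * (w a).2 - (z a).2 * (w a).1) +
        (((z b).1 * (w b).2 - (z b).2 * (w b).1) + ∑ i ∈ (Finset.univ.erase a).erase b,
        ((z i).1 * (w i).2 - (z i).2 * (w i).1)) := fun z w => by
      rw [om, ← Finset.add_sum_erase _ _ (Finset.mem_univ a), ← Finset.add_sum_erase _ _
        (Finset.mem_erase.2 ⟨hab.symm, Finset.mem_univ b⟩)]
    rw [hsplit, hsplit x, Finset.sum_congr rfl (g := fun i => (x i).1 * (y i).2 - (x i).2 * (y i).1)]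
    · have := hF (x a, x b) (y a, y b)
      simp only [locFun, LinearMap.coe_mk, AddHom.coe_mk, if_true, if_neg hab.symm]
      linarith
    · intro i hi
      simp only [Finset.mem_erase] at hi
      simp [locFun, hi.1, hi.2.1]

variable {hF : PairIsometry F} {hF' : PairIsometry F'}

theorem act_loc (hab : a ≠ b) (x : l → ℤ × ℤ) (i : l) : act (loc F hF a b hab) x i =
    if i = a then (F (x a, x b)).1 else if i = b then (F (x a, x b)).2 else x i := by
  simp [loc, locFun]

theorem P_conj_loc (hab : a ≠ b) (π : Equiv.Perm l) :
    P π * loc F hF a b hab * (P π)⁻¹ = loc F hF (π a) (π b) (π.injective.ne hab) := by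
  refine act_ext fun x => ?_
  funext i
  obtain ⟨i, rfl⟩ := π.surjective i
  simp [act_loc]

/-- Exchanging the two handles inverts the element; this is what lets an involution invert `sig` and
`rot`. -/
theorem loc_swap_mul_loc (hab : a ≠ b) (h : ∀ p, F (F p).swap = p.swap) :
    loc F hF b a hab.symm * loc F hF a b hab = 1 := by
  refine act_ext fun x => ?_
  funext i
  have h1 := h (x a, x b)
  simp only [Prod.swap] at h1
  simp only [act_mul, act_loc, act_one, if_true, if_neg hab.symm, h1]
  split_ifs with hb ha <;> simp [*]

theorem loc_cube (hab : a ≠ b) (h : ∀ p, F (F (F p)) = p) : loc F hF a b hab ^ 3 = 1 := by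
  refine act_ext fun x => ?_
  funext i
  simp only [pow_succ, pow_zero, one_mul, act_mul, act_loc, act_one, if_true, if_neg hab.symm, h]
  split_ifs with hb ha <;> simp [*]

theorem loc_commute (hab : a ≠ b) (hcd : c ≠ d) (hac : a ≠ c) (had : a ≠ d) (hbc : b ≠ c)
    (hbd : b ≠ d) : Commute (loc F hF a b hab) (loc F' hF' c d hcd) := by
  refine act_ext fun x => ?_
  funext i
  simp only [act_mul, act_loc, if_neg hac, if_neg hac.symm, if_neg had, if_neg had.symm, if_neg hbc,
    if_neg hbc.symm, if_neg hbd, if_neg hbd.symm]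
  rcases eq_or_ne i a with rfl | ha
  · simp [hac, had]
  rcases eq_or_ne i b with rfl | hb
  · simp [hbc, hbd]
  simp [ha, hb]

end Loc

/-- An element of order three mixing two handles within the two standard Lagrangians. -/
def sigF : (ℤ × ℤ) × (ℤ × ℤ) →ₗ[ℤ] (ℤ × ℤ) × (ℤ × ℤ) where
  toFun p := ((-p.2.1, -p.1.2 - p.2.2), (p.1.1 - p.2.1, p.1.2))
  map_add' p q := by ext <;> simp <;> ring
  map_smul' k p := by ext <;> simp <;> ring

/-- An element of order three of `SL₂(ℤ)` on the first handle and its inverse on the second. -/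
def rotF : (ℤ × ℤ) × (ℤ × ℤ) →ₗ[ℤ] (ℤ × ℤ) × (ℤ × ℤ) where
  toFun p := ((-p.1.2, p.1.1 - p.1.2), (p.2.2 - p.2.1, -p.2.1))
  map_add' p q := by ext <;> simp <;> ring
  map_smul' k p := by ext <;> simp <;> ring

theorem sigF_apply (p : (ℤ × ℤ) × (ℤ × ℤ)) :
    sigF p = ((-p.2.1, -p.1.2 - p.2.2), (p.1.1 - p.2.1, p.1.2)) := rfl

theorem rotF_apply (p : (ℤ × ℤ) × (ℤ × ℤ)) :
    rotF p = ((-p.1.2, p.1.1 - p.1.2), (p.2.2 - p.2.1, -p.2.1)) := rfl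

theorem sigF_isometry : PairIsometry sigF := fun p q => by simp only [sigF_apply]; ring

theorem rotF_isometry : PairIsometry rotF := fun p q => by simp only [rotF_apply]; ring

theorem sigF_swap (p : (ℤ × ℤ) × (ℤ × ℤ)) : sigF (sigF p).swap = p.swap := by
  ext <;> simp [sigF_apply]

theorem rotF_swap (p : (ℤ × ℤ) × (ℤ × ℤ)) : rotF (rotF p).swap = p.swap := by
  ext <;> simp [rotF_apply]

theorem sigF_cube (p : (ℤ × ℤ) × (ℤ × ℤ)) : sigF (sigF (sigF p)) = p := by
  ext <;> simp [sigF_apply] <;> ring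

theorem rotF_cube (p : (ℤ × ℤ) × (ℤ × ℤ)) : rotF (rotF (rotF p)) = p := by
  ext <;> simp [rotF_apply] <;> ring

/-- The element `sigF` on the handles `a` and `b`. -/
abbrev sig (a b : l) (hab : a ≠ b) : symplecticGroup l ℤ := loc sigF sigF_isometry a b hab

/-- The element `rotF` on the handles `a` and `b`. -/
abbrev rot (a b : l) (hab : a ≠ b) : symplecticGroup l ℤ := loc rotF rotF_isometry a b hab

/-! ### From short root elements to transvections. -/

/-- `M` is the short root element `x ↦ x + ω(x, u) v + ω(x, v) u`. -/
def IsShortRoot (M : symplecticGroup l ℤ) (u v : l → ℤ × ℤ) : Prop :=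
  ∀ x, act M x = x + om x u • v + om x v • u

theorem IsShortRoot.conj {M : symplecticGroup l ℤ} {u v : l → ℤ × ℤ} (h : IsShortRoot M u v)
    (W : symplecticGroup l ℤ) : IsShortRoot (W * M * W⁻¹) (act W u) (act W v) := fun x => by
  obtain ⟨x, rfl⟩ : ∃ y, x = act W y := ⟨act W⁻¹ x, by simp⟩
  rw [act_mul, act_mul, act_inv_act, h, om_act, om_act]
  simp only [map_add, map_smul]

/-- For fixed v these elements multiply as in a Heisenberg group: the u's add, up to a central power
of T(v) given by their pairings. With sum zero only the central term survives. -/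
theorem IsShortRoot.mul_mul_eq_T_inv {M₀ M₁ M₂ : symplecticGroup l ℤ} {u₀ u₁ u₂ v : l → ℤ × ℤ}
    (h₀ : IsShortRoot M₀ u₀ v) (h₁ : IsShortRoot M₁ u₁ v) (h₂ : IsShortRoot M₂ u₂ v)
    (hsum : u₀ + u₁ + u₂ = 0) (h10 : om u₁ u₀ = -1) (h0 : om u₀ v = 0) (h1 : om u₁ v = 0) :
    M₀ * M₁ * M₂ = (T v)⁻¹ := by
  obtain rfl : u₂ = -u₀ - u₁ := by
    rw [← sub_eq_zero, ← hsum]; abel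
  refine act_ext fun x => ?_
  have h01 : om u₀ u₁ = 1 := by rw [om_swap, h10]; rfl
  have h0' : om v u₀ = 0 := by rw [om_swap, h0]; rfl
  have h1' : om v u₁ = 0 := by rw [om_swap, h1]; rfl
  rw [act_mul, act_mul, h₂, h₁, h₀, act_T_inv]
  simp only [om_add_left, om_smul_left, om_sub_left, om_sub_right, om_neg_left, om_neg_right, h0,
    h1, h0', h1', h10, h01, om_self]
  module

theorem act_loc_single_left {F : (ℤ × ℤ) × (ℤ × ℤ) →ₗ[ℤ] (ℤ × ℤ) × (ℤ × ℤ)}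
    {hF : PairIsometry F} {a b : l} (hab : a ≠ b) (u : ℤ × ℤ) :
    act (loc F hF a b hab) (Pi.single a u) =
      Pi.single a (F (u, 0)).1 + Pi.single b (F (u, 0)).2 := by
  funext i
  rw [act_loc]
  rcases eq_or_ne i a with rfl | ha
  · simp [hab, hab.symm]
  rcases eq_or_ne i b with rfl | hb
  · simp [ha]
  simp [ha, hb]

theorem act_loc_single_right {F : (ℤ × ℤ) × (ℤ × ℤ) →ₗ[ℤ] (ℤ × ℤ) × (ℤ × ℤ)}
    {hF : PairIsometry F} {a b : l} (hab : a ≠ b) (u : ℤ × ℤ) :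
    act (loc F hF a b hab) (Pi.single b u) =
      Pi.single a (F (0, u)).1 + Pi.single b (F (0, u)).2 := by
  funext i
  rw [act_loc]
  rcases eq_or_ne i a with rfl | ha
  · simp [hab]
  rcases eq_or_ne i b with rfl | hb
  · simp [ha, ha.symm]
  simp [ha, hb]

theorem act_loc_single_of_ne {F : (ℤ × ℤ) × (ℤ × ℤ) →ₗ[ℤ] (ℤ × ℤ) × (ℤ × ℤ)}
    {hF : PairIsometry F} {a b c : l} (hab : a ≠ b) (hca : c ≠ a) (hcb : c ≠ b) (u : ℤ × ℤ) :
    act (loc F hF a b hab) (Pi.single c u) = Pi.single c u := by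
  have h0 : F (0, 0) = 0 := map_zero F
  funext i
  rw [act_loc]
  rcases eq_or_ne i a with rfl | ha
  · simp [hca.symm, hcb.symm, h0]
  rcases eq_or_ne i b with rfl | hb
  · simp [ha, hca.symm, hcb.symm, h0]
  simp [ha, hb]

theorem act_rot_single_left {a b : l} (hab : a ≠ b) (u : ℤ × ℤ) :
    act (rot a b hab) (Pi.single a u) = Pi.single a (-u.2, u.1 - u.2) := by
  simp [act_loc_single_left, rotF_apply]

/-- Each factor `sig` times a swap negates handle a up to a shear with the other handle; in the
product the signs cancel and the shears combine. -/
theorem isShortRoot_sig {a b c : l} (hab : a ≠ b) (hac : a ≠ c) (hbc : b ≠ c) :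
    IsShortRoot (sig a b hab * P (Equiv.swap a b) * (sig a c hac * P (Equiv.swap a c)))
      (fb a) (eb b - eb c) := by
  intro x
  funext i
  simp only [act_mul, act_loc, act_P, Equiv.symm_swap, sigF_apply, Equiv.swap_apply_left,
    Equiv.swap_apply_right, om_single_right, om_sub_right, if_true, if_neg hab.symm,
    if_neg hbc, Equiv.swap_apply_of_ne_of_ne hab.symm hbc]
  rcases eq_or_ne i a with rfl | ha
  · ext
    · simp [hab, hac]
    · simp [hab, hac]
      ring
  rcases eq_or_ne i b with rfl | hb
  · ext <;> simp [ha, hbc]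
  rcases eq_or_ne i c with rfl | hc
  · ext
    · simp [ha, hb, Equiv.swap_apply_of_ne_of_ne]
      ring
    · simp [ha, hb, Equiv.swap_apply_of_ne_of_ne]
  · simp [ha, hb, hc, Equiv.swap_apply_of_ne_of_ne]

section

variable {H : Subgroup (symplecticGroup l ℤ)}

theorem T_act_mem {M : symplecticGroup l ℤ} {v : l → ℤ × ℤ} (hM : M ∈ H) (hv : T v ∈ H) :
    T (act M v) ∈ H := by
  rw [← T_conj]
  exact H.mul_mem (H.mul_mem hM hv) (H.inv_mem hM)

/-- Conjugation by `rot a d` fixes v = e_b - e_c and moves f_a through an orbit of length three with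
sum zero, since 1 + ρ + ρ² = 0 on handle a. The auxiliary handles a and d are why four are required.
-/
theorem T_e_sub_e_mem (hP : ∀ π, P π ∈ H) (hsig : ∀ a b hab, sig a b hab ∈ H)
    (hrot : ∀ a b hab, rot a b hab ∈ H) {a b c d : l} (hab : a ≠ b) (hac : a ≠ c) (had : a ≠ d)
    (hbc : b ≠ c) (hbd : b ≠ d) (hcd : c ≠ d) : T (eb b - eb c) ∈ H := by
  set U := sig a b hab * P (Equiv.swap a b) * (sig a c hac * P (Equiv.swap a c))
  have hUm : U ∈ H :=
    H.mul_mem (H.mul_mem (hsig _ _ _) (hP _)) (H.mul_mem (hsig _ _ _) (hP _))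
  have hU : IsShortRoot U (fb a) (eb b - eb c) := isShortRoot_sig hab hac hbc
  have hWm := hrot a d had
  have hv : act (rot a d had) (eb b - eb c) = eb b - eb c := by
    rw [map_sub, act_loc_single_of_ne had hab.symm hbd, act_loc_single_of_ne had hac.symm hcd]
  have hU₁ := hU.conj (rot a d had)
  have hU₂ := hU₁.conj (rot a d had)
  rw [hv, act_rot_single_left] at hU₁ hU₂
  rw [hv, act_rot_single_left] at hU₂
  have h := hU.mul_mul_eq_T_inv hU₁ hU₂
    (by rw [← Pi.single_add, ← Pi.single_add]; simp) (by rw [om_single_left]; simp)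
    (by rw [om_single_left]; simp [hab, hac]) (by rw [om_single_left]; simp [hab, hac])
  rw [← inv_mem_iff, ← h]
  have hm₁ := H.mul_mem (H.mul_mem hWm hUm) (H.inv_mem hWm)
  exact H.mul_mem (H.mul_mem hUm hm₁) (H.mul_mem (H.mul_mem hWm hm₁) (H.inv_mem hWm))

theorem hasTransvections_of_mem (hl : 4 ≤ Fintype.card l) (hP : ∀ π, P π ∈ H)
    (hsig : ∀ a b hab, sig a b hab ∈ H) (hrot : ∀ a b hab, rot a b hab ∈ H) :
    HasTransvections H := by
  have hex : ∀ s : Finset l, s.card < 4 → ∃ a, a ∉ s := fun s hs => by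
    by_contra! h
    rw [(Finset.eq_univ_iff_forall).2 h, Finset.card_univ] at hs
    omega
  have hee : ∀ b c, b ≠ c → T (eb b - eb c) ∈ H := fun b c hbc => by
    obtain ⟨a, ha⟩ := hex {b, c} (Finset.card_le_two.trans_lt (by norm_num))
    obtain ⟨d, hd⟩ := hex {a, b, c} (Finset.card_le_three.trans_lt (by norm_num))
    simp only [Finset.mem_insert, Finset.mem_singleton, not_or] at ha hd
    exact T_e_sub_e_mem hP hsig hrot ha.1 ha.2 (Ne.symm hd.1) hbc (Ne.symm hd.2.1) (Ne.symm hd.2.2)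
  have hef : ∀ b c, b ≠ c → T (eb b - fb c) ∈ H := fun b c hbc => by
    obtain ⟨a, ha⟩ := hex {b, c} (Finset.card_le_two.trans_lt (by norm_num))
    simp only [Finset.mem_insert, Finset.mem_singleton, not_or] at ha
    have h := T_act_mem (hrot c a (Ne.symm ha.2)) (hee b c hbc)
    rw [map_sub, act_rot_single_left, act_loc_single_of_ne _ hbc (Ne.symm ha.1)] at h
    simpa using h
  have hfe : ∀ b c, b ≠ c → T (fb b + eb c) ∈ H := fun b c hbc => by
    have h := T_act_mem (hsig b c hbc) (hef b c hbc)
    rw [map_sub, act_loc_single_left, act_loc_single_right] at h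
    simp only [sigF_apply] at h
    convert h using 2
    have h0 : ((0 : ℤ), (0 : ℤ)) = 0 := rfl
    simp [sub_eq_add_neg, ← Pi.single_neg, add_comm, h0]
  have he : ∀ b, T (eb b) ∈ H := fun b => by
    obtain ⟨c, hc⟩ := hex {b} (by simp)
    obtain ⟨a, ha⟩ := hex {b, c} (Finset.card_le_two.trans_lt (by norm_num))
    simp only [Finset.mem_insert, Finset.mem_singleton, not_or] at ha hc
    have hba : b ≠ a := Ne.symm ha.1
    have h1 : T (eb b + eb c) ∈ H := by
      have h := T_act_mem (hrot b a hba) (T_act_mem (hrot b a hba) (hfe b c (Ne.symm hc)))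
      rw [map_add, map_add, act_rot_single_left, act_rot_single_left,
        act_loc_single_of_ne _ hc (Ne.symm ha.2), act_loc_single_of_ne _ hc (Ne.symm ha.2)] at h
      simpa using h
    -- This cancels the e_c component, leaving e_b + f_b on a single handle; `rot` takes that to
    -- -e_b.
    have h2 := T_act_mem (hef c b hc) h1
    have h3 : act (T (eb c - fb b)) (eb b + eb c) = Pi.single b (1, 1) := by
      rw [act_T]
      simp only [om_add_left, om_sub_right, om_single_left]
      simp only [Pi.single_eq_same, Pi.single_eq_of_ne hc, Pi.single_eq_of_ne (Ne.symm hc)]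
      have : (Pi.single b (1, 1) : l → ℤ × ℤ) = eb b + fb b := by simp [← Pi.single_add]
      rw [this]
      simp
    rw [h3] at h2
    have h4 := T_act_mem (hrot b a hba) h2
    rw [act_rot_single_left, ← T_neg, ← Pi.single_neg] at h4
    simpa using h4
  refine ⟨he, fun b => ?_, hfe⟩
  obtain ⟨a, ha⟩ := hex {b} (by simp)
  have h := T_act_mem (hrot b a (by simpa [eq_comm] using ha)) (he b)
  rw [act_rot_single_left] at h
  simpa using h

end

end SymplecticInvolutions

/-! ### The three involutions. -/

namespace SymplecticInvolutions

theorem exists_perm_apply_eq_apply_eq {l : Type*} [DecidableEq l] {a b c d : l} (hab : a ≠ b) (hcd : c ≠ d) :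
    ∃ π : Equiv.Perm l, π a = c ∧ π b = d := by
  have h : Equiv.swap a c b ≠ c := fun h => hab (by
    rw [← (Equiv.swap a c).injective.eq_iff, h, Equiv.swap_apply_left])
  refine ⟨Equiv.swap (Equiv.swap a c b) d * Equiv.swap a c, ?_, ?_⟩
  · rw [Equiv.Perm.mul_apply, Equiv.swap_apply_left, Equiv.swap_apply_of_ne_of_ne h.symm hcd]
  · rw [Equiv.Perm.mul_apply, Equiv.swap_apply_left]

theorem mul_conj_eq_inv {G : Type*} [Group G] {x p s r : G} (hp : x * p * x⁻¹ = p⁻¹)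
    (hs : x * s * x⁻¹ = s⁻¹) (hr : x * r * x⁻¹ = r⁻¹) (hps : Commute p s) (hpr : Commute p r)
    (hsr : Commute s r) : x * (p * s * r) * x⁻¹ = (p * s * r)⁻¹ := by
  have h : x * (p * s * r) * x⁻¹ = (x * p * x⁻¹) * (x * s * x⁻¹) * (x * r * x⁻¹) := by group
  rw [h, hp, hs, hr, hps.inv_inv.eq, (hsr.inv_inv.mul_left hpr.inv_inv).eq, _root_.mul_inv_rev,
    _root_.mul_inv_rev]

variable {l : Type*} [Fintype l] [DecidableEq l]

theorem P_injective : Function.Injective (P : Equiv.Perm l →* symplecticGroup l ℤ) := by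
  intro π ρ h
  ext1 i
  have h1 : act (P π) (eb i) (π i) = act (P ρ) (eb i) (π i) := by rw [h]
  rw [act_P, act_P, Equiv.symm_apply_apply] at h1
  have h2 : ρ.symm (π i) = i := by
    by_contra hne
    simp [hne] at h1
  rw [← h2, Equiv.apply_symm_apply, h2]

theorem loc_swap_eq_inv {F : (ℤ × ℤ) × (ℤ × ℤ) →ₗ[ℤ] (ℤ × ℤ) × (ℤ × ℤ)} {hF : PairIsometry F}
    {a b : l} (hab : a ≠ b) (h : ∀ p, F (F p).swap = p.swap) :
    loc F hF b a hab.symm = (loc F hF a b hab)⁻¹ :=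
  eq_inv_of_mul_eq_one_left (loc_swap_mul_loc hab h)

/-- A pair-isometry element lies in `H` for all pairs as soon as it does for one. -/
theorem loc_mem_of_mem {H : Subgroup (symplecticGroup l ℤ)} (hP : ∀ π, P π ∈ H)
    {F : (ℤ × ℤ) × (ℤ × ℤ) →ₗ[ℤ] (ℤ × ℤ) × (ℤ × ℤ)} {hF : PairIsometry F}
    {a b : l} {hab : a ≠ b} (h : loc F hF a b hab ∈ H) (c d : l) (hcd : c ≠ d) :
    loc F hF c d hcd ∈ H := by
  obtain ⟨π, rfl, rfl⟩ := exists_perm_apply_eq_apply_eq hab hcd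
  rw [← P_conj_loc hab π]
  exact H.mul_mem (H.mul_mem (hP π) h) (H.inv_mem (hP π))

theorem exists_three_involutions {x₀ y₀ : Equiv.Perm l} {i j a b c d : l}
    (hx : x₀ * x₀ = 1) (hy : y₀ * y₀ = 1) (hy1 : y₀ ≠ 1) (hxy : x₀ ≠ y₀)
    (hxi : x₀ i = j) (hxa : x₀ a = b) (hxc : x₀ c = d)
    (hnd : [i, j, a, b, c, d].Nodup)
    (hgen : Subgroup.closure {x₀ * y₀, Equiv.swap i j} = ⊤) :
    ∃ x y z : symplecticGroup l ℤ, x ≠ y ∧ x ≠ z ∧ y ≠ z ∧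
      orderOf x = 2 ∧ orderOf y = 2 ∧ orderOf z = 2 ∧ Subgroup.closure {x, y, z} = ⊤ := by
  have hl : 4 ≤ Fintype.card l := le_trans (by simp) hnd.length_le_card
  simp only [List.nodup_cons, List.mem_cons, List.not_mem_nil, or_false, not_or, not_false_iff,
    List.nodup_nil, and_true] at hnd
  obtain ⟨⟨hij, hia, hib, hic, hid⟩, ⟨hja, hjb, hjc, hjd⟩, ⟨hab, hac, had⟩, ⟨hbc, hbd⟩, hcd⟩ := hnd
  have hxx : ∀ k, x₀ (x₀ k) = k := fun k => by rw [← Equiv.Perm.mul_apply, hx]; rfl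
  have hxj : x₀ j = i := by rw [← hxi, hxx]
  have hxb : x₀ b = a := by rw [← hxa, hxx]
  have hxd : x₀ d = c := by rw [← hxc, hxx]
  set x := P x₀ with hxdef
  set y := P y₀ with hydef
  set p := P (Equiv.swap i j) with hpdef
  set s := sig a b hab with hsdef
  set r := rot c d hcd with hrdef
  have hpp : p * p = 1 := by rw [hpdef, ← map_mul, Equiv.swap_mul_self, map_one]
  have hs3 : s ^ 3 = 1 := loc_cube hab sigF_cube
  have hr3 : r ^ 3 = 1 := loc_cube hcd rotF_cube
  have hps : Commute p s := by
    have h := P_conj_loc (hF := sigF_isometry) hab (Equiv.swap i j)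
    simp only [Equiv.swap_apply_of_ne_of_ne (Ne.symm hia) (Ne.symm hja),
      Equiv.swap_apply_of_ne_of_ne (Ne.symm hib) (Ne.symm hjb)] at h
    exact mul_inv_eq_iff_eq_mul.1 h
  have hpr : Commute p r := by
    have h := P_conj_loc (hF := rotF_isometry) hcd (Equiv.swap i j)
    simp only [Equiv.swap_apply_of_ne_of_ne (Ne.symm hic) (Ne.symm hjc),
      Equiv.swap_apply_of_ne_of_ne (Ne.symm hid) (Ne.symm hjd)] at h
    exact mul_inv_eq_iff_eq_mul.1 h
  have hsr : Commute s r := loc_commute hab hcd hac had hbc hbd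
  have hxp : x * p * x⁻¹ = p⁻¹ := by
    rw [hxdef, hpdef, ← map_inv, ← map_inv, ← map_mul, ← map_mul, Equiv.mul_swap_eq_swap_mul, hxi,
      hxj, mul_inv_cancel_right, Equiv.swap_inv, Equiv.swap_comm]
  have hxs : x * s * x⁻¹ = s⁻¹ := by
    rw [hxdef, hsdef, P_conj_loc, ← loc_swap_eq_inv hab sigF_swap]
    simp only [hxa, hxb]
  have hxr : x * r * x⁻¹ = r⁻¹ := by
    rw [hxdef, hrdef, P_conj_loc, ← loc_swap_eq_inv hcd rotF_swap]
    simp only [hxc, hxd]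
  have hx2 : x * x = 1 := by rw [hxdef, ← map_mul, hx, map_one]
  have hy2 : y * y = 1 := by rw [hydef, ← map_mul, hy, map_one]
  set h := p * s * r with hh
  have hz2 : (x * h) * (x * h) = 1 := by
    have h1 := mul_conj_eq_inv hxp hxs hxr hps hpr hsr
    rw [inv_eq_of_mul_eq_one_left hx2, ← hh] at h1
    rw [← mul_assoc, h1, inv_mul_cancel]
  -- Cubing kills s and r and leaves p, an involution.
  have hh3 : h ^ 3 = p := by
    rw [hh, (hpr.mul_left hsr).mul_pow, hps.mul_pow, hs3, hr3, pow_succ, pow_two, hpp]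
    simp
  -- The third element sends e_c to f_d, which no permutation of handles does; so it differs from x,
  -- y and 1.
  have hzP : ∀ π, x * h ≠ P π := fun π hπ => by
    have h1 : act (x * h) (eb c) d = (0, 1) := by
      rw [hh, act_mul, act_mul, act_mul, hrdef, act_rot_single_left, hsdef,
        act_loc_single_of_ne _ (Ne.symm hac) (Ne.symm hbc), hxdef, act_P, hpdef, act_P,
        ← hxc, Equiv.symm_apply_apply, Equiv.symm_swap,
        Equiv.swap_apply_of_ne_of_ne (Ne.symm hic) (Ne.symm hjc)]
      simp
    rw [hπ, act_P] at h1
    rcases eq_or_ne (π.symm d) c with hc | hc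
    · simp [hc] at h1
    · simpa [hc] using congrArg Prod.snd h1
  have hx1 : x₀ ≠ 1 := fun h1 => hij (by rw [← hxi, h1]; rfl)
  refine ⟨x, y, x * h, P_injective.ne hxy, (hzP _).symm, (hzP _).symm,
    orderOf_eq_prime (by rw [pow_two, hx2]) ?_, orderOf_eq_prime (by rw [pow_two, hy2]) ?_,
    orderOf_eq_prime (by rw [pow_two, hz2]) ?_, ?_⟩
  · rw [← map_one P]; exact P_injective.ne hx1
  · rw [← map_one P]; exact P_injective.ne hy1
  · rw [← map_one P]; exact hzP 1
  set H := Subgroup.closure {x, y, x * h} with hH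
  have hxm : x ∈ H := Subgroup.subset_closure (by simp)
  have hym : y ∈ H := Subgroup.subset_closure (by simp)
  have hhm : h ∈ H := by
    have : x * h ∈ H := Subgroup.subset_closure (by simp)
    exact (H.mul_mem_cancel_left hxm).1 this
  have hpm : p ∈ H := hh3 ▸ H.pow_mem hhm 3
  have hP : ∀ π, P π ∈ H := by
    have htop : H.comap P = ⊤ := by
      rw [← top_le_iff, ← hgen, Subgroup.closure_le]
      rintro π (rfl | rfl)
      · simpa using H.mul_mem hxm hym
      · exact hpm
    intro π
    have : π ∈ H.comap P := htop ▸ Subgroup.mem_top π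
    exact this
  have hsrm : s * r ∈ H := by
    rw [hh, mul_assoc] at hhm
    exact (H.mul_mem_cancel_left hpm).1 hhm
  -- Conjugating by the swap of c and d fixes s and inverts r.
  have hsrm' : s * r⁻¹ ∈ H := by
    have h1 := H.mul_mem (H.mul_mem (hP (Equiv.swap c d)) hsrm) (H.inv_mem (hP (Equiv.swap c d)))
    have h2 := P_conj_loc (hF := sigF_isometry) hab (Equiv.swap c d)
    simp only [Equiv.swap_apply_of_ne_of_ne hac had, Equiv.swap_apply_of_ne_of_ne hbc hbd] at h2
    have h3 := P_conj_loc (hF := rotF_isometry) hcd (Equiv.swap c d)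
    simp only [Equiv.swap_apply_left, Equiv.swap_apply_right] at h3
    rw [loc_swap_eq_inv hcd rotF_swap] at h3
    have h4 : P (Equiv.swap c d) * (s * r) * (P (Equiv.swap c d))⁻¹ =
        (P (Equiv.swap c d) * s * (P (Equiv.swap c d))⁻¹) *
          (P (Equiv.swap c d) * r * (P (Equiv.swap c d))⁻¹) := by group
    rw [h4, h2, h3] at h1
    exact h1
  have hsm : s ∈ H := by
    have h1 : (s * r) * (s * r⁻¹) = s ^ 2 := by
      rw [hsr.eq, mul_assoc, ← mul_assoc s, ← pow_two, (hsr.inv_right.pow_left 2).eq]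
      simp
    -- The product of sr and sr⁻¹ is s², and s⁴ = s.
    have h2 : s = (s ^ 2) ^ 2 := by
      rw [← pow_mul, show 2 * 2 = 3 + 1 from rfl, pow_succ, hs3, one_mul]
    rw [h2, ← h1]
    exact H.pow_mem (H.mul_mem hsrm hsrm') 2
  have hrm : r ∈ H := (H.mul_mem_cancel_left hsm).1 hsrm
  exact (hasTransvections_of_mem hl hP (fun a b hab => loc_mem_of_mem hP hsm a b hab)
    (fun a b hab => loc_mem_of_mem hP hrm a b hab)).eq_top

end SymplecticInvolutions

open SymplecticInvolutions in
theorem mainTheorem4 (g : ℕ) (hg : 6 ≤ g) :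
    ∃ x y z : Matrix.symplecticGroup (Fin g) ℤ,
      x ≠ y ∧ x ≠ z ∧ y ≠ z ∧
      orderOf x = 2 ∧ orderOf y = 2 ∧ orderOf z = 2 ∧
      Subgroup.closure {x, y, z} = (⊤ : Subgroup (Matrix.symplecticGroup (Fin g) ℤ)) := by
  obtain ⟨m, rfl⟩ := Nat.exists_eq_add_of_le' hg
  have hR : (Equiv.subLeft 1 : Equiv.Perm (Fin (m + 6))) * Equiv.neg _ = finRotate (m + 6) := by
    ext1 i
    rw [finRotate_apply, Equiv.Perm.mul_apply, Equiv.neg_apply, Equiv.subLeft_apply,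
      sub_neg_eq_add, add_comm 1 i]
  -- Modulo m + 6, the map i ↦ 1 - i exchanges the pairs {0, 1}, {2, -1}, {3, -2}; they are disjoint
  -- because there are at least six handles.
  refine exists_three_involutions (x₀ := Equiv.subLeft 1) (y₀ := Equiv.neg _) (i := 0) (j := 1)
    (a := ⟨2, by omega⟩) (b := ⟨m + 5, by omega⟩) (c := ⟨3, by omega⟩) (d := ⟨m + 4, by omega⟩)
    ?_ ?_ ?_ ?_ ?_ ?_ ?_ ?_ ?_
  · ext1 i; simp
  · ext1 i; simp
  · intro h
    have := congrArg Fin.val (Equiv.congr_fun h 1)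
    simp at this
  · intro h
    have := congrArg Fin.val (Equiv.congr_fun h 0)
    simp at this
  · simp
  · simp [Fin.sub_def]
  · simp [Fin.sub_def]
  · simp [Fin.ext_iff]
  · rw [hR]
    have h := Equiv.Perm.closure_cycle_adjacent_swap (isCycle_finRotate (n := m + 4))
      support_finRotate 0
    rwa [finRotate_apply, zero_add] at h
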